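/- **Setting.** Let $n\ge 1$ and $d\ge 0$ be integers, and let $(x_i,y_i)_{i=1}^n$ be random data with $x_i\in\mathbb R^d$ and $y_i\in\{-1,+1\}$, such that $(x_1,\dots,x_n)$ has a joint density with respect to Lebesgue measure on $(\mathbb R^d)^n$ (for instance, $x_1,\dots,x_n$ are i.i.d. from a density on $\mathbb R^d$); the labels may depend on the $x_i$ in any way. Let $z_i:=-y_ix_i$, let $\|\cdot\|$ be the Euclidean norm, and let $$\mathcal R(w):=\frac1n\sum_{i=1}^n e^{\langle w,z_i\rangle}$$ be the empirical risk of the exponential loss. Gradient descent is started from $w_0=0$, with $w_{t+1}:=w_t-\eta_t\nabla\mathcal R(w_t)$ for step sizes $\eta_t\ge 0$; write $\hat\eta_t:=\eta_t\mathcal R(w_t)$. Let $\gamma:=\max_{\|u\|=1}\min_i\langle u,-z_i\rangle$ be the maximum margin and $\bar u$ the maximum margin direction, i.e. the unit vector attaining $\gamma$. For $a\in\mathbb R^d$ let $\Pi_\perp[a]:=a-\langle a,\bar u\rangle\bar u$, and put $v_t:=\Pi_\perp[w_t]$ and $z_{i,\perp}:=\Pi_\perp[z_i]$. Let $S:=\{z_i:\langle\bar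 u,-z_i\rangle=\gamma\}$ be the set of support vectors, $S_\perp:=\{z_{i,\perp}:z_i\in S\}$, $$\mathcal R_\perp(w):=\frac1n\sum_{z_i\in S}e^{\langle w,z_{i,\perp}\rangle},\qquad \gamma':=\min_{z_i\notin S}\langle\bar u,-z_i\rangle-\gamma,$$ with $\gamma':=\infty$ if every $z_i$ is in $S$ (and then $\frac{2\ln n}{\gamma\gamma'}:=0$). **Theorem.** Almost surely, if $\|x_i\|\le 1$ for all $i$ and the data are linearly separable (there is $u\in\mathbb R^d$ with $y_i\langle u,x_i\rangle>0$ for all $i$), then $\bar u$ exists and is unique, $\mathcal R_\perp$ has a unique minimizer $\bar v$ over $\mathrm{span}(S_\perp)$, and, for every sequence of step sizes $\eta_j\ge0$ for which $(\hat\eta_j)_{j\ge0}$ is nonincreasing with $\hat\eta_j\le1$ for all $j$, and for every $t\ge0$, $$\|v_t-\bar v\|\le\max\{\|v_0-\bar v\|,2\}+\frac{2\ln n}{\gamma\gamma'}+2 .$$ -/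

import Mathlib

open MeasureTheory ProbabilityTheory

/-- The feature space `ℝ^d` with the `ℓ₂` norm. -/
abbrev Vec (d : ℕ) : Type := EuclideanSpace ℝ (Fin d)

/-- The signed data points `z_i = - y_i x_i`. -/
noncomputable def signedData {n d : ℕ} (x : Fin n → Vec d) (y : Fin n → ℝ) : Fin n → Vec d :=
  fun i => -(y i • x i)

/-- Linear separability: some `u` has `y_i ⟨u, x_i⟩ > 0` for every `i`. -/
def LinearlySeparable {n d : ℕ} (x : Fin n → Vec d) (y : Fin n → ℝ) : Prop :=
  ∃ u : Vec d, ∀ i, 0 < y i * inner ℝ u (x i)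

/-- The empirical risk `R(w) = (1/n) ∑ exp ⟨w, z_i⟩` of the exponential loss. -/
noncomputable def risk {n d : ℕ} (z : Fin n → Vec d) (w : Vec d) : ℝ :=
  (1 / (n : ℝ)) * ∑ i, Real.exp (inner ℝ w (z i))

/-- Gradient descent `w_{t+1} = w_t - η_t ∇R(w_t)` on the risk, started from `w_0 = 0`. -/
noncomputable def gdIterate {n d : ℕ} (z : Fin n → Vec d) (η : ℕ → ℝ) : ℕ → Vec d
  | 0 => 0
  | t + 1 => gdIterate z η t - η t • gradient (risk z) (gdIterate z η t)

/-- The normalized step size `η_t R(w_t)`. -/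
noncomputable def normalizedStep {n d : ℕ} (z : Fin n → Vec d) (η : ℕ → ℝ) (t : ℕ) : ℝ :=
  η t * risk z (gdIterate z η t)

/-- The margin `min_i ⟨u, -z_i⟩ = min_i y_i ⟨u, x_i⟩` of `u`. -/
noncomputable def margin {n d : ℕ} (z : Fin n → Vec d) (u : Vec d) : ℝ :=
  ⨅ i, inner ℝ u (-z i)

/-- The maximum margin `γ`, over all unit vectors. -/
noncomputable def maxMargin {n d : ℕ} (z : Fin n → Vec d) : ℝ :=
  ⨆ u : Metric.sphere (0 : Vec d) 1, margin z u

/-- `u` is a maximum margin direction: a unit vector that maximizes the margin. -/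
def IsMaxMarginDirection {n d : ℕ} (z : Fin n → Vec d) (u : Vec d) : Prop :=
  u ∈ Metric.sphere (0 : Vec d) 1 ∧ IsMaxOn (margin z) (Metric.sphere (0 : Vec d) 1) u

/-- The component of `a` orthogonal to the unit vector `u`. -/
noncomputable def perp {d : ℕ} (u a : Vec d) : Vec d := a - (inner ℝ a u : ℝ) • u

/-- The indices of the support vectors, that is, `⟨u, -z_i⟩ = γ`. -/
noncomputable def supportIdx {n d : ℕ} (z : Fin n → Vec d) (u : Vec d) : Finset (Fin n) :=
  Finset.univ.filter fun i => inner ℝ u (-z i) = maxMargin z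

/-- `span(S_⊥)`: the span of the orthogonal components of the support vectors. -/
noncomputable def supportPerpSpan {n d : ℕ} (z : Fin n → Vec d) (u : Vec d) :
    Submodule ℝ (Vec d) :=
  Submodule.span ℝ ((fun i => perp u (z i)) '' (supportIdx z u : Set (Fin n)))

/-- `R_⊥(w) = (1/n) ∑_{z_i ∈ S} exp ⟨w, z_{i,⊥}⟩`. -/
noncomputable def riskPerp {n d : ℕ} (z : Fin n → Vec d) (u : Vec d) (w : Vec d) : ℝ :=
  (1 / (n : ℝ)) * ∑ i ∈ supportIdx z u, Real.exp (inner ℝ w (perp u (z i)))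

/-- `v` is a minimizer of `R_⊥` over `span(S_⊥)`. -/
def IsRiskPerpMinimizer {n d : ℕ} (z : Fin n → Vec d) (u v : Vec d) : Prop :=
  v ∈ supportPerpSpan z u ∧ IsMinOn (riskPerp z u) (supportPerpSpan z u : Set (Vec d)) v

/-- The gap `γ' = min_{z_i ∉ S} ⟨u, -z_i⟩ - γ`; it is `∞` if every data point is a
support vector. -/
noncomputable def marginGap {n d : ℕ} (z : Fin n → Vec d) (u : Vec d) : EReal :=
  ⨅ i ∈ (supportIdx z u)ᶜ, ((inner ℝ u (-z i) - maxMargin z : ℝ) : EReal)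

/-!
Write `γ` for the maximum margin, `ū` for its direction, `h t = η_t R(w_t)` for the normalized step
sizes and `F w = log ∑ i, exp ⟪w, z i⟫`. Since `∇R = R ∇F`, gradient descent on `R` with steps `η`
is gradient descent on `F` with steps `h t ≤ 1`, and `∇F w` is the mean of the `z i` under the
softmax weights of `w`. As `‖z i‖ ≤ 1`, Hoeffding's lemma makes log-sum-exp `1`-smooth.

*Contraction.* Up to a common factor, the softmax weights of `w` on the support vectors are those
of `Π_⊥ w` for the projected support vectors. Hence one step on `v_t = Π_⊥ w_t` is a step of length
at most one on `log R_⊥`, which does not increase the distance to the minimizer `v̄`, followed by a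
displacement of length at most `h t * Q t`, where `Q t` is the softmax weight of the points that
are not support vectors. So `‖v_t - v̄‖ ≤ ‖v_0 - v̄‖ + ∑ j < t, h j * Q j`
(`norm_perp_gdIterate_sub_le`).

*Mirror descent.* The softmax weights perform mirror descent on the dual objective
`‖∑ i, q i • z i‖² / 2`, whose minimum is `γ² / 2`. The regret bound, proved here through the potential `F + γ ⟪·, ū⟫`, reads
`∑ j < t, h j * (‖∇F (w (j + 1))‖² - γ²) / 2 ≤ log n`. As `‖∇F (w j)‖ ≥ γ + γ' Q j` and `h` is
nonincreasing, `∑ j < t, h j * Q j ≤ log n / (γ γ') + 1` (`sum_mul_sum_softmax_le`).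

*Existence of the minimizer.* The point of minimal norm of the convex hull of the `-z i` is `γ ū`,
which gives dual weights supported on the support vectors (`exists_isMaxMarginDirection`). Almost
surely all support vectors have positive weight (`ne_zero_of_mem_supportIdx`): a support vector of
weight zero would lie on a hyperplane determined by the other data points, an event of measure zero
(`volume_setOf_exists_inner_eq`). Thus `0` is a combination with positive weights of the projected
support vectors, and `R_⊥` has compact sublevel sets in their span (`exists_isMinOn_sum_exp`).
-/

/-! ### Log-sum-exp -/

section LogSumExp

variable {ι : Type*}

/-- **Hoeffding's lemma** for a finitely supported probability distribution. -/
lemma sum_mul_exp_le_exp_of_abs_le {s : Finset ι} {q a : ι → ℝ} {c : ℝ}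
    (hq : ∀ i ∈ s, 0 ≤ q i) (hq1 : ∑ i ∈ s, q i = 1) (ha : ∀ i ∈ s, |a i| ≤ c) :
    ∑ i ∈ s, q i * Real.exp (a i) ≤ Real.exp (∑ i ∈ s, q i * a i + c ^ 2 / 2) := by
  classical
  let : MeasurableSpace ι := ⊤
  have hint (f : ι → ℝ) (i : ι) : Integrable f (ENNReal.ofReal (q i) • Measure.dirac i) :=
    ((integrable_dirac (by simp)).smul_measure ENNReal.ofReal_ne_top)
  let μ : Measure ι := ∑ i ∈ s, ENNReal.ofReal (q i) • Measure.dirac i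
  have hμ (f : ι → ℝ) : ∫ i, f i ∂μ = ∑ i ∈ s, q i * f i := by
    rw [integral_finsetSum_measure fun i _ => hint f i]
    refine Finset.sum_congr rfl fun i hi => ?_
    rw [integral_smul_measure, integral_dirac, ENNReal.toReal_ofReal (hq i hi), smul_eq_mul]
  have hprob : IsProbabilityMeasure μ := ⟨by
    simp only [μ, Measure.coe_finsetSum, Finset.sum_apply, Measure.smul_apply, measure_univ,
      smul_eq_mul, mul_one]
    rw [← ENNReal.ofReal_sum_of_nonneg hq, hq1, ENNReal.ofReal_one]⟩
  have hbd : ∀ᵐ i ∂μ, a i ∈ Set.Icc (-c) c := by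
    have : μ {i | ¬ a i ∈ Set.Icc (-c) c} = 0 := by
      simp only [μ, Measure.coe_finsetSum, Finset.sum_apply, Measure.smul_apply, smul_eq_mul]
      refine Finset.sum_eq_zero fun i hi => ?_
      have := abs_le.1 (ha i hi)
      rw [Measure.dirac_apply' _ MeasurableSpace.measurableSet_top, Set.indicator_of_notMem, mul_zero]
      simpa using this
    exact this
  have h := (hasSubgaussianMGF_of_mem_Icc (measurable_from_top (f := a)).aemeasurable hbd).mgf_le 1
  rw [mgf, hμ, hμ] at h
  have hc : ((‖c - -c‖₊ / 2) ^ 2 : NNReal) = c ^ 2 := by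
    push_cast
    rw [Real.norm_eq_abs, div_pow, sq_abs]
    ring
  push_cast at hc h
  rw [hc] at h
  simp only [one_mul, one_pow, mul_one, Real.exp_sub, mul_div_assoc'] at h
  rwa [← Finset.sum_div, div_le_iff₀ (Real.exp_pos _), ← Real.exp_add, add_comm (c ^ 2 / 2)] at h

variable {E : Type*} [NormedAddCommGroup E] [InnerProductSpace ℝ E]

/-- The log-sum-exp function `w ↦ log ∑ i ∈ s, exp ⟪w, z i⟫`. -/
noncomputable def logSumExp (s : Finset ι) (z : ι → E) (w : E) : ℝ :=
  Real.log (∑ i ∈ s, Real.exp (inner ℝ w (z i)))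

/-- The softmax weights of the scores `⟪w, z i⟫`, `i ∈ s`. -/
noncomputable def softmax (s : Finset ι) (z : ι → E) (w : E) (i : ι) : ℝ :=
  Real.exp (inner ℝ w (z i)) / ∑ j ∈ s, Real.exp (inner ℝ w (z j))

/-- The softmax-weighted mean of the `z i`, which is the gradient of `logSumExp` at `w`. -/
noncomputable def softmaxMean (s : Finset ι) (z : ι → E) (w : E) : E :=
  ∑ i ∈ s, softmax s z w i • z i

variable {s : Finset ι} {z : ι → E}

lemma sum_exp_inner_pos (hs : s.Nonempty) (w : E) :
    0 < ∑ i ∈ s, Real.exp (inner ℝ w (z i)) :=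
  Finset.sum_pos (fun _ _ => Real.exp_pos _) hs

lemma exp_logSumExp (hs : s.Nonempty) (w : E) :
    Real.exp (logSumExp s z w) = ∑ i ∈ s, Real.exp (inner ℝ w (z i)) :=
  Real.exp_log (sum_exp_inner_pos hs w)

lemma softmax_nonneg (w : E) (i : ι) : 0 ≤ softmax s z w i :=
  div_nonneg (Real.exp_pos _).le (Finset.sum_nonneg fun _ _ => (Real.exp_pos _).le)

lemma sum_softmax (hs : s.Nonempty) (w : E) : ∑ i ∈ s, softmax s z w i = 1 := by
  simp only [softmax]
  rw [← Finset.sum_div, div_self (sum_exp_inner_pos hs w).ne']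

lemma inner_softmaxMean (w x : E) :
    inner ℝ (softmaxMean s z w) x = ∑ i ∈ s, softmax s z w i * inner ℝ x (z i) := by
  simp only [softmaxMean, sum_inner, inner_smul_left, real_inner_comm]
  rfl

lemma exp_logSumExp_add (hs : s.Nonempty) (w δ : E) :
    Real.exp (logSumExp s z (w + δ)) =
      Real.exp (logSumExp s z w) * ∑ i ∈ s, softmax s z w i * Real.exp (inner ℝ δ (z i)) := by
  rw [exp_logSumExp hs, exp_logSumExp hs, Finset.mul_sum]
  refine Finset.sum_congr rfl fun i _ => ?_
  have := (sum_exp_inner_pos (z := z) hs w).ne'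
  rw [inner_add_left, Real.exp_add, softmax]
  field_simp

/-- The gradient inequality expressing convexity of log-sum-exp. -/
lemma logSumExp_add_inner_le (hs : s.Nonempty) (w δ : E) :
    logSumExp s z w + inner ℝ (softmaxMean s z w) δ ≤ logSumExp s z (w + δ) := by
  rw [← Real.exp_le_exp, exp_logSumExp_add hs, Real.exp_add, inner_softmaxMean]
  gcongr
  simpa using convexOn_exp.map_sum_le (t := s) (w := softmax s z w)
    (p := fun i => inner ℝ δ (z i)) (fun i _ => softmax_nonneg w i) (sum_softmax hs w) (by simp)

/-- Log-sum-exp over vectors of norm at most one is `1`-smooth. -/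
lemma logSumExp_add_le (hs : s.Nonempty) (hz : ∀ i ∈ s, ‖z i‖ ≤ 1) (w δ : E) :
    logSumExp s z (w + δ) ≤
      logSumExp s z w + inner ℝ (softmaxMean s z w) δ + ‖δ‖ ^ 2 / 2 := by
  rw [← Real.exp_le_exp, exp_logSumExp_add hs, add_assoc, Real.exp_add, inner_softmaxMean]
  gcongr
  refine sum_mul_exp_le_exp_of_abs_le (fun i _ => softmax_nonneg w i) (sum_softmax hs w)
    fun i hi => (abs_real_inner_le_norm _ _).trans ?_
  exact mul_le_of_le_one_right (norm_nonneg _) (hz i hi)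

/-- The strengthening of the gradient inequality available for a `1`-smooth convex function. For
log-sum-exp it plays the role of Pinsker's inequality between two softmax distributions. -/
lemma logSumExp_add_inner_add_le (hs : s.Nonempty) (hz : ∀ i ∈ s, ‖z i‖ ≤ 1) (x y : E) :
    logSumExp s z y + inner ℝ (softmaxMean s z y) (x - y) +
      ‖softmaxMean s z y - softmaxMean s z x‖ ^ 2 / 2 ≤ logSumExp s z x := by
  -- compare the values at `x` and `y` through the point `x + δ`
  set δ := softmaxMean s z y - softmaxMean s z x with hδ
  have h1 := logSumExp_add_inner_le (z := z) hs y (x + δ - y)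
  have h2 := logSumExp_add_le hs hz x δ
  rw [add_sub_cancel, show x + δ - y = (x - y) + δ by abel, inner_add_right] at h1
  have h3 : inner ℝ (softmaxMean s z y) δ - inner ℝ (softmaxMean s z x) δ = ‖δ‖ ^ 2 := by
    rw [← inner_sub_left, ← hδ, real_inner_self_eq_norm_sq]
  linarith

/-- A gradient step of length `a ≤ 1` on log-sum-exp does not increase the distance to a
minimizer. -/
lemma norm_sub_smul_softmaxMean_sub_le (hs : s.Nonempty) (hz : ∀ i ∈ s, ‖z i‖ ≤ 1) {v₀ : E}
    (hv₀ : ∀ v, logSumExp s z v₀ ≤ logSumExp s z v) (v : E) {a : ℝ} (ha0 : 0 ≤ a) (ha1 : a ≤ 1) :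
    ‖v - a • softmaxMean s z v - v₀‖ ≤ ‖v - v₀‖ := by
  set g := softmaxMean s z v with hg
  -- co-coercivity `‖g‖² / 2 ≤ ⟪v - v₀, g⟫`: compare `v₀` with the full gradient step `v - g`
  have h1 := hv₀ (v + -g)
  have h2 := logSumExp_add_le hs hz v (-g)
  have h3 := logSumExp_add_inner_le (z := z) hs v (v₀ - v)
  rw [add_sub_cancel, ← hg] at h3
  rw [← hg, inner_neg_right, real_inner_self_eq_norm_sq, norm_neg] at h2
  have h4 : inner ℝ g (v₀ - v) = - inner ℝ (v - v₀) g := by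
    rw [← neg_sub v v₀, inner_neg_right, real_inner_comm]
  refine pow_le_pow_iff_left₀ (norm_nonneg _) (norm_nonneg _) two_ne_zero |>.1 ?_
  have h5 : v - a • g - v₀ = (v - v₀) - a • g := by abel
  rw [h5, norm_sub_sq_real, inner_smul_right, norm_smul, mul_pow, Real.norm_eq_abs, sq_abs]
  nlinarith [mul_nonneg ha0 (sub_nonneg.2 ha1), sq_nonneg ‖g‖,
    mul_nonneg (mul_nonneg ha0 (sub_nonneg.2 ha1)) (sq_nonneg ‖g‖)]

end LogSumExp

/-! ### Normalized gradient descent as mirror descent on the dual -/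

section MirrorDescent

variable {ι E : Type*} [NormedAddCommGroup E] [InnerProductSpace ℝ E] {s : Finset ι} {z : ι → E}
  {w : ℕ → E} {h : ℕ → ℝ} {u : E} {γ : ℝ}

/-- If `-γ u` is a convex combination of the `z i`, then `logSumExp + γ ⟪·, u⟫` is nonnegative. -/
lemma logSumExp_add_mul_inner_nonneg {q : ι → ℝ} (hs : s.Nonempty) (hq : ∀ i ∈ s, 0 ≤ q i)
    (hq1 : ∑ i ∈ s, q i = 1) (hqu : ∑ i ∈ s, q i • z i = -(γ • u)) (x : E) :
    0 ≤ logSumExp s z x + γ * inner ℝ x u := by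
  have h1 : ∑ i ∈ s, q i * inner ℝ x (z i) = -(γ * inner ℝ x u) := by
    simp_rw [← inner_smul_right, ← inner_sum, hqu,
      inner_neg_right]
  have h2 : Real.exp (∑ i ∈ s, q i * inner ℝ x (z i)) ≤ Real.exp (logSumExp s z x) := by
    rw [exp_logSumExp hs]
    refine (convexOn_exp.map_sum_le (t := s) (w := q) (p := fun i => inner ℝ x (z i)) hq hq1
      (by simp)).trans (Finset.sum_le_sum fun i hi => ?_)
    exact mul_le_of_le_one_left (Real.exp_pos _).le (hq1 ▸ Finset.single_le_sum hq hi)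
  have h3 := Real.exp_le_exp.1 h2
  linarith

/-- One step decreases the potential `logSumExp + γ ⟪·, u⟫` by the dual suboptimality of the
*next* iterate. -/
lemma potential_step_le (hs : s.Nonempty) (hz : ∀ i ∈ s, ‖z i‖ ≤ 1) (hu : ‖u‖ = 1) (x : E) {a : ℝ}
    (ha0 : 0 ≤ a) (ha1 : a ≤ 1) :
    logSumExp s z (x - a • softmaxMean s z x) + γ * inner ℝ (x - a • softmaxMean s z x) u +
        a * ((‖softmaxMean s z (x - a • softmaxMean s z x)‖ ^ 2 - γ ^ 2) / 2) ≤
      logSumExp s z x + γ * inner ℝ x u := by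
  set g := softmaxMean s z x
  set x' := x - a • g with hx'
  set g' := softmaxMean s z x'
  have h1 : logSumExp s z x' + inner ℝ g' (x - x') + ‖g' - g‖ ^ 2 / 2 ≤ logSumExp s z x :=
    logSumExp_add_inner_add_le hs hz x x'
  rw [show x - x' = a • g by rw [hx']; abel, inner_smul_right] at h1
  have h2 : ‖g' - g‖ ^ 2 = ‖g'‖ ^ 2 - 2 * inner ℝ g' g + ‖g‖ ^ 2 := norm_sub_sq_real _ _
  have h3 : inner ℝ x' u = inner ℝ x u - a * inner ℝ g u := by
    rw [hx', inner_sub_left, real_inner_smul_left]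
  -- Young's inequality `-2 γ ⟪g, u⟫ ≤ ‖g‖² + γ²`
  have h4 : 0 ≤ ‖g + γ • u‖ ^ 2 := sq_nonneg _
  rw [norm_add_sq_real, inner_smul_right, norm_smul, hu, mul_one, Real.norm_eq_abs, sq_abs] at h4
  rw [h3]
  nlinarith [mul_nonneg ha0 h4, mul_nonneg (sub_nonneg.2 ha1) (sq_nonneg ‖g' - g‖)]

/-- The regret bound of mirror descent with the entropy: the initial potential is `log #s`, and
the potential stays nonnegative. -/
lemma sum_mul_norm_softmaxMean_sq_sub_le {q : ι → ℝ} (hs : s.Nonempty) (hz : ∀ i ∈ s, ‖z i‖ ≤ 1)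
    (hu : ‖u‖ = 1) (hq : ∀ i ∈ s, 0 ≤ q i) (hq1 : ∑ i ∈ s, q i = 1)
    (hqu : ∑ i ∈ s, q i • z i = -(γ • u)) (hw0 : w 0 = 0)
    (hw : ∀ t, w (t + 1) = w t - h t • softmaxMean s z (w t))
    (hh0 : ∀ t, 0 ≤ h t) (hh1 : ∀ t, h t ≤ 1) (t : ℕ) :
    ∑ j ∈ Finset.range t, h j * ((‖softmaxMean s z (w (j + 1))‖ ^ 2 - γ ^ 2) / 2) ≤
      Real.log s.card := by
  have key : logSumExp s z (w t) + γ * inner ℝ (w t) u +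
      ∑ j ∈ Finset.range t, h j * ((‖softmaxMean s z (w (j + 1))‖ ^ 2 - γ ^ 2) / 2) ≤
        Real.log s.card := by
    induction t with
    | zero => simp [hw0, logSumExp]
    | succ t ih =>
      have := potential_step_le (γ := γ) hs hz hu (w t) (hh0 t) (hh1 t)
      rw [← hw] at this
      rw [Finset.sum_range_succ]
      linarith
  linarith [logSumExp_add_mul_inner_nonneg hs hq hq1 hqu (w t)]

/-- If every `z i` has margin at least `γ`, and those outside `s'` have margin at least `γ + δ`,
then the softmax weight outside `s'` is controlled by the excess norm of the softmax mean. -/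
lemma mul_sum_softmax_le_norm_sq_sub {s' : Finset ι} {δ : ℝ} [DecidableEq ι] (hs : s.Nonempty)
    (hs' : s' ⊆ s) (hu : ‖u‖ = 1) (hγ : 0 ≤ γ) (hδ : 0 ≤ δ) (hmargin : ∀ i ∈ s, γ ≤ inner ℝ u (-z i))
    (hgap : ∀ i ∈ s \ s', γ + δ ≤ inner ℝ u (-z i)) (x : E) :
    γ * δ * ∑ i ∈ s \ s', softmax s z x i ≤ (‖softmaxMean s z x‖ ^ 2 - γ ^ 2) / 2 := by
  set Q := ∑ i ∈ s \ s', softmax s z x i with hQ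
  have hQ0 : 0 ≤ Q := Finset.sum_nonneg fun _ _ => softmax_nonneg _ _
  have h1 : γ + δ * Q ≤ inner ℝ (softmaxMean s z x) (-u) := by
    rw [inner_softmaxMean, ← Finset.sum_sdiff hs']
    have hsum := sum_softmax (z := z) hs x
    rw [← Finset.sum_sdiff hs', ← hQ] at hsum
    have h2 : (γ + δ) * Q ≤ ∑ i ∈ s \ s', softmax s z x i * inner ℝ (-u) (z i) := by
      rw [hQ, Finset.mul_sum]
      refine Finset.sum_le_sum fun i hi => ?_
      rw [mul_comm, inner_neg_left, ← inner_neg_right]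
      exact mul_le_mul_of_nonneg_left (hgap i hi) (softmax_nonneg _ _)
    have h3 : γ * ∑ i ∈ s', softmax s z x i ≤
        ∑ i ∈ s', softmax s z x i * inner ℝ (-u) (z i) := by
      rw [Finset.mul_sum]
      refine Finset.sum_le_sum fun i hi => ?_
      rw [mul_comm, inner_neg_left, ← inner_neg_right]
      exact mul_le_mul_of_nonneg_left (hmargin i (hs' hi)) (softmax_nonneg _ _)
    rw [eq_sub_of_add_eq' hsum] at h3
    linarith
  have h2 : inner ℝ (softmaxMean s z x) (-u) ≤ ‖softmaxMean s z x‖ := by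
    simpa [hu] using real_inner_le_norm (softmaxMean s z x) (-u)
  have h3 : (γ + δ * Q) ^ 2 ≤ ‖softmaxMean s z x‖ ^ 2 :=
    pow_le_pow_left₀ (by positivity) (h1.trans h2) 2
  nlinarith [sq_nonneg (δ * Q)]

/-- The total step length spent outside the support vectors is bounded. The regret bound pairs the
step `h j` with the iterate `j + 1`; monotonicity of the steps realigns the two, at the price of
the first step. -/
lemma sum_mul_sum_softmax_le {s' : Finset ι} {δ : ℝ} [DecidableEq ι] {q : ι → ℝ} (hs : s.Nonempty)
    (hs' : s' ⊆ s) (hz : ∀ i ∈ s, ‖z i‖ ≤ 1) (hu : ‖u‖ = 1) (hγ : 0 < γ) (hδ : 0 < δ)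
    (hmargin : ∀ i ∈ s, γ ≤ inner ℝ u (-z i))
    (hgap : ∀ i ∈ s \ s', γ + δ ≤ inner ℝ u (-z i)) (hq : ∀ i ∈ s, 0 ≤ q i)
    (hq1 : ∑ i ∈ s, q i = 1) (hqu : ∑ i ∈ s, q i • z i = -(γ • u)) (hw0 : w 0 = 0)
    (hw : ∀ t, w (t + 1) = w t - h t • softmaxMean s z (w t))
    (hh0 : ∀ t, 0 ≤ h t) (hh1 : ∀ t, h t ≤ 1) (hanti : Antitone h) (t : ℕ) :
    ∑ j ∈ Finset.range t, h j * ∑ i ∈ s \ s', softmax s z (w j) i ≤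
      Real.log s.card / (γ * δ) + 1 := by
  set Q : ℕ → ℝ := fun j => ∑ i ∈ s \ s', softmax s z (w j) i with hQ
  have hQ0 (j) : 0 ≤ Q j := Finset.sum_nonneg fun _ _ => softmax_nonneg _ _
  have hQ1 : Q 0 ≤ 1 := (Finset.sum_le_sum_of_subset_of_nonneg Finset.sdiff_subset
    fun _ _ _ => softmax_nonneg _ _).trans (sum_softmax hs _).le
  have hfirst : h 0 * Q 0 ≤ 1 := mul_le_one₀ (hh1 0) (hQ0 0) hQ1
  have htail : ∑ j ∈ Finset.range t, h (j + 1) * Q (j + 1) ≤ Real.log s.card / (γ * δ) := by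
    rw [le_div_iff₀' (by positivity), Finset.mul_sum]
    refine le_trans (Finset.sum_le_sum fun j _ => ?_)
      (sum_mul_norm_softmaxMean_sq_sub_le hs hz hu hq hq1 hqu hw0 hw hh0 hh1 t)
    have h1 := mul_sum_softmax_le_norm_sq_sub hs hs' hu hγ.le hδ.le hmargin hgap (w (j + 1))
    have h2 : h (j + 1) * (γ * δ * Q (j + 1)) ≤ h j * (γ * δ * Q (j + 1)) :=
      mul_le_mul_of_nonneg_right (hanti j.le_succ) (mul_nonneg (by positivity) (hQ0 _))
    have h3 := mul_le_mul_of_nonneg_left h1 (hh0 j)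
    linarith
  have hle : ∑ j ∈ Finset.range t, h j * Q j ≤ ∑ j ∈ Finset.range (t + 1), h j * Q j :=
    Finset.sum_le_sum_of_subset_of_nonneg (Finset.range_mono t.le_succ)
      fun j _ _ => mul_nonneg (hh0 j) (hQ0 j)
  rw [Finset.sum_range_succ'] at hle
  linarith

end MirrorDescent

/-! ### The maximum margin direction and its dual certificate -/

section MaxMargin

variable {n d : ℕ} {z : Fin n → Vec d}

lemma margin_le (z : Fin n → Vec d) (u : Vec d) (i : Fin n) : margin z u ≤ inner ℝ u (-z i) :=
  ciInf_le (Set.finite_range _).bddBelow i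

/-- Dual weights for the maximum margin problem: the point `p` is the element of minimal norm in
the convex hull of the `-z i`. -/
lemma exists_dual_weights [Nonempty (Fin n)] (hsep : ∃ u : Vec d, ∀ i, 0 < inner ℝ u (-z i)) :
    ∃ (q : Fin n → ℝ) (p : Vec d), (∀ i, 0 ≤ q i) ∧ ∑ i, q i = 1 ∧ ∑ i, q i • (-z i) = p ∧
      p ≠ 0 ∧ ∀ i, ‖p‖ ^ 2 ≤ inner ℝ p (-z i) := by
  let K : Set (Vec d) := convexHull ℝ (Set.range fun i => -z i)
  have hK : IsCompact K := (Set.finite_range _).isCompact_convexHull ℝ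
  obtain ⟨p, hpK, hp⟩ := exists_norm_eq_iInf_of_complete_convex
    ((Set.range_nonempty _).convexHull (𝕜 := ℝ)) hK.isComplete (convex_convexHull ℝ _) (0 : Vec d)
  have hmin := (norm_eq_iInf_iff_real_inner_le_zero (convex_convexHull ℝ _) hpK).1 hp
  rw [convexHull_range_eq_exists_affineCombination] at hpK
  obtain ⟨s, c, hc0, hc1, hcp⟩ := hpK
  rw [s.affineCombination_eq_linear_combination _ _ hc1] at hcp
  let q : Fin n → ℝ := fun i => if i ∈ s then c i else 0
  have hq0 (i) : 0 ≤ q i := by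
    by_cases hi : i ∈ s
    · simpa [q, hi] using hc0 i hi
    · simp [q, hi]
  have hq1 : ∑ i, q i = 1 := by simpa [q] using hc1
  have hqp : ∑ i, q i • (-z i) = p := by
    rw [← hcp]
    simp [q, ite_smul]
  refine ⟨q, p, hq0, hq1, hqp, ?_, fun i => ?_⟩
  · rintro rfl
    obtain ⟨u, hu⟩ := hsep
    have h0 : ∑ i, q i * inner ℝ u (-z i) = 0 := by
      simp_rw [← inner_smul_right, ← inner_sum, hqp, inner_zero_right]
    rw [Finset.sum_eq_zero_iff_of_nonneg fun i _ => mul_nonneg (hq0 i) (hu i).le] at h0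
    have : ∑ i, q i = 0 := Finset.sum_eq_zero fun i hi =>
      (mul_eq_zero.1 (h0 i hi)).resolve_right (hu i).ne'
    simp [this] at hq1
  · have h := hmin (-z i) (subset_convexHull ℝ _ ⟨i, rfl⟩)
    rw [zero_sub, inner_neg_left, inner_sub_right, real_inner_self_eq_norm_sq] at h
    linarith

/-- The KKT conditions of the maximum margin problem, with existence and uniqueness of the
solution. -/
lemma exists_isMaxMarginDirection [Nonempty (Fin n)]
    (hsep : ∃ u : Vec d, ∀ i, 0 < inner ℝ u (-z i)) :
    ∃ (u : Vec d) (q : Fin n → ℝ), IsMaxMarginDirection z u ∧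
      (∀ u', IsMaxMarginDirection z u' → u' = u) ∧ 0 < maxMargin z ∧ (∀ i, 0 ≤ q i) ∧
      ∑ i, q i = 1 ∧ ∑ i, q i • z i = -(maxMargin z • u) ∧ ∀ i, maxMargin z ≤ inner ℝ u (-z i) := by
  obtain ⟨q, p, hq0, hq1, hqp, hp0, hp⟩ := exists_dual_weights hsep
  have hpos : 0 < ‖p‖ := norm_pos_iff.2 hp0
  set u₀ : Vec d := ‖p‖⁻¹ • p with hu₀
  have hu₀1 : ‖u₀‖ = 1 := by rw [hu₀, norm_smul, norm_inv, norm_norm, inv_mul_cancel₀ hpos.ne']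
  have hpu₀ : p = ‖p‖ • u₀ := by rw [hu₀, smul_inv_smul₀ hpos.ne']
  have hlow (i) : ‖p‖ ≤ inner ℝ u₀ (-z i) := by
    rw [hu₀, real_inner_smul_left, inv_mul_eq_div, le_div_iff₀ hpos, ← sq]
    exact hp i
  have hlow' : ‖p‖ ≤ margin z u₀ := le_ciInf hlow
  have hup (u : Vec d) : margin z u ≤ inner ℝ u p := by
    calc margin z u = ∑ i, q i * margin z u := by rw [← Finset.sum_mul, hq1, one_mul]
      _ ≤ ∑ i, q i * inner ℝ u (-z i) :=
        Finset.sum_le_sum fun i _ => mul_le_mul_of_nonneg_left (margin_le z u i) (hq0 i)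
      _ = inner ℝ u p := by simp_rw [← inner_smul_right, ← inner_sum, hqp]
  have hup' (u : Vec d) (hu : ‖u‖ = 1) : margin z u ≤ ‖p‖ :=
    (hup u).trans (by simpa [hu] using real_inner_le_norm u p)
  have hmax : IsMaxMarginDirection z u₀ :=
    ⟨by simpa using hu₀1, fun u hu => (hup' u (by simpa using hu)).trans hlow'⟩
  have hγ : maxMargin z = ‖p‖ := by
    have : Nonempty (Metric.sphere (0 : Vec d) 1) := ⟨⟨u₀, hmax.1⟩⟩
    refine le_antisymm (ciSup_le fun u => hup' u (by simp)) (hlow'.trans ?_)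
    refine le_ciSup (f := fun u : Metric.sphere (0 : Vec d) 1 => margin z u)
      ⟨‖p‖, ?_⟩ ⟨u₀, hmax.1⟩
    rintro _ ⟨u, rfl⟩
    exact hup' u (by simp)
  refine ⟨u₀, q, hmax, fun u hu => ?_, hγ ▸ hpos, hq0, hq1, ?_, fun i => hγ ▸ hlow i⟩
  · have hu1 : ‖u‖ = 1 := by simpa using hu.1
    have h1 : ‖p‖ ≤ inner ℝ u p := (hlow'.trans (hu.2 hmax.1)).trans (hup u)
    -- equality in the Cauchy-Schwarz inequality
    have h2 : inner ℝ u u₀ = 1 := by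
      refine le_antisymm (by simpa [hu1, hu₀1] using real_inner_le_norm u u₀) ?_
      rw [hu₀, inner_smul_right, inv_mul_eq_div, le_div_iff₀ hpos, one_mul]
      exact h1
    exact (inner_eq_one_iff_of_norm_eq_one hu1 hu₀1).1 h2
  · rw [hγ, ← hpu₀, ← hqp]
    simp

/-- Complementary slackness. -/
lemma mem_supportIdx_of_ne_zero {u : Vec d} {q : Fin n → ℝ} (hu : ‖u‖ = 1) (hq0 : ∀ i, 0 ≤ q i)
    (hq1 : ∑ i, q i = 1) (hqu : ∑ i, q i • z i = -(maxMargin z • u))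
    (hmargin : ∀ i, maxMargin z ≤ inner ℝ u (-z i)) {i : Fin n} (hi : q i ≠ 0) :
    i ∈ supportIdx z u := by
  have h0 : ∑ i, q i * (inner ℝ u (-z i) - maxMargin z) = 0 := by
    have : ∑ i, q i * inner ℝ u (-z i) = maxMargin z := by
      simp_rw [inner_neg_right, mul_neg, ← inner_smul_right, Finset.sum_neg_distrib, ← inner_sum,
        hqu, inner_neg_right, inner_smul_right, real_inner_self_eq_norm_sq, hu]
      ring
    simp_rw [mul_sub, Finset.sum_sub_distrib, this, ← Finset.sum_mul, hq1, one_mul, sub_self]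
  rw [Finset.sum_eq_zero_iff_of_nonneg
    fun i _ => mul_nonneg (hq0 i) (sub_nonneg.2 (hmargin i))] at h0
  have := (mul_eq_zero.1 (h0 i (Finset.mem_univ i))).resolve_left hi
  simpa [supportIdx] using sub_eq_zero.1 this

end MaxMargin

/-! ### Data with a density are in general position -/

section GeneralPosition

lemma IsSigmaCompact.measurableSet {X : Type*} [TopologicalSpace X] [T2Space X]
    [MeasurableSpace X] [OpensMeasurableSpace X] {s : Set X} (hs : IsSigmaCompact s) :
    MeasurableSet s := by
  obtain ⟨K, hK, rfl⟩ := hs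
  exact MeasurableSet.iUnion fun n => (hK n).measurableSet

variable {d : ℕ}

lemma volume_setOf_inner_eq_zero (p : Vec d) {c : ℝ} (hc : c ≠ 0) :
    volume {ξ : Vec d | inner ℝ p ξ = c} = 0 := by
  let H : AffineSubspace ℝ (Vec d) :=
    { carrier := {ξ | inner ℝ p ξ = c}
      smul_vsub_vadd_mem' := fun a ξ₁ ξ₂ ξ₃ h₁ h₂ h₃ => by
        simp only [Set.mem_ofPred_eq] at h₁ h₂ h₃ ⊢
        simp [inner_add_right, inner_sub_right, inner_smul_right, h₁, h₂, h₃] }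
  refine Measure.addHaar_affineSubspace volume H fun h => ?_
  have h0 : (0 : Vec d) ∈ H := h ▸ AffineSubspace.mem_top ℝ _ _
  have h1 : inner ℝ p (0 : Vec d) = c := h0
  exact hc (by simpa using h1.symm)

/-- A vector in the span of `x i`, `i ∈ I`, is determined by its inner products with them. -/
lemma sum_smul_eq_of_inner_eq {ι E : Type*} [NormedAddCommGroup E] [InnerProductSpace ℝ E]
    {I : Finset ι} {x : ι → E} {c c' : ι → ℝ}
    (h : ∀ i ∈ I, inner ℝ (∑ j ∈ I, c j • x j) (x i) = inner ℝ (∑ j ∈ I, c' j • x j) (x i)) :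
    ∑ j ∈ I, c j • x j = ∑ j ∈ I, c' j • x j := by
  rw [← sub_eq_zero, ← inner_self_eq_zero (𝕜 := ℝ)]
  nth_rewrite 2 [← Finset.sum_sub_distrib]
  simp_rw [← sub_smul, inner_sum, inner_smul_right, inner_sub_left]
  exact Finset.sum_eq_zero fun i hi => by rw [h i hi, sub_self, mul_zero]

/-- Suppose a vector `p` of the span of the `x i`, `i ∈ I`, satisfies `⟪p, x i⟫ = σ i` on `I`. Then
`p` is unique and does not depend on `x k`, `k ∉ I`, so that by Fubini's theorem `x k` almost surely
avoids the hyperplane `⟪p, ·⟫ = σ k`. The exceptional set is measurable because it is the projection of a closed set, hence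
σ-compact. -/
lemma volume_setOf_exists_inner_eq {m : ℕ} {k : Fin (m + 1)} {I : Finset (Fin (m + 1))}
    (hk : k ∉ I) {σ : Fin (m + 1) → ℝ} (hσ : σ k ≠ 0) :
    volume {x : Fin (m + 1) → Vec d | ∃ c : Fin (m + 1) → ℝ,
      (∀ i ∈ I, inner ℝ (∑ j ∈ I, c j • x j) (x i) = σ i) ∧
        inner ℝ (∑ j ∈ I, c j • x j) (x k) = σ k} = 0 := by
  set A := {x : Fin (m + 1) → Vec d | ∃ c : Fin (m + 1) → ℝ,
      (∀ i ∈ I, inner ℝ (∑ j ∈ I, c j • x j) (x i) = σ i) ∧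
        inner ℝ (∑ j ∈ I, c j • x j) (x k) = σ k} with hA
  have hAm : MeasurableSet A := by
    let C : Set ((Fin (m + 1) → Vec d) × (Fin (m + 1) → ℝ)) :=
      {p | (∀ i ∈ I, inner ℝ (∑ j ∈ I, p.2 j • p.1 j) (p.1 i) = σ i) ∧
        inner ℝ (∑ j ∈ I, p.2 j • p.1 j) (p.1 k) = σ k}
    have hC : IsClosed C := by
      have hCI : C = (⋂ i ∈ I, {p | inner ℝ (∑ j ∈ I, p.2 j • p.1 j) (p.1 i) = σ i}) ∩
          {p | inner ℝ (∑ j ∈ I, p.2 j • p.1 j) (p.1 k) = σ k} := by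
        ext p
        simp [C]
      rw [hCI]
      refine IsClosed.inter ?_ (isClosed_eq (by fun_prop) continuous_const)
      exact isClosed_biInter fun i _ => isClosed_eq (by fun_prop) continuous_const
    have hAC : A = Prod.fst '' C := by
      ext x
      simp [hA, C]
    rw [hAC]
    exact ((isSigmaCompact_univ.of_isClosed_subset hC (Set.subset_univ _)).image
      continuous_fst).measurableSet
  have hmp := (volume_preserving_piFinSuccAbove (fun _ : Fin (m + 1) => Vec d) k).symm
  rw [← hmp.measure_preimage hAm.nullMeasurableSet, Measure.volume_eq_prod,
    Measure.prod_apply_symm (hmp.measurable hAm), lintegral_eq_zero_of_ae_eq_zero]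
  refine Filter.Eventually.of_forall fun x' => ?_
  rcases Set.eq_empty_or_nonempty ((fun ξ => (ξ, x')) ⁻¹'
    ((MeasurableEquiv.piFinSuccAbove (fun _ : Fin (m + 1) => Vec d) k).symm ⁻¹' A)) with
    h | ⟨ξ₀, c₀, h₀, -⟩
  · exact (congrArg volume h).trans measure_empty
  set X : Vec d → Fin (m + 1) → Vec d := fun ξ =>
    (MeasurableEquiv.piFinSuccAbove (fun _ : Fin (m + 1) => Vec d) k).symm (ξ, x') with hX
  have hXk (ξ) : X ξ k = ξ := Fin.insertNth_apply_same (α := fun _ => Vec d) k ξ x'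
  have hXi (ξ) {i} (hi : i ∈ I) : X ξ i = X ξ₀ i := by
    obtain ⟨i, rfl⟩ := Fin.exists_succAbove_eq (x := i) (y := k) (by rintro rfl; exact hk hi)
    exact (Fin.insertNth_apply_succAbove (α := fun _ => Vec d) k ξ x' i).trans
      (Fin.insertNth_apply_succAbove (α := fun _ => Vec d) k ξ₀ x' i).symm
  refine measure_mono_null ?_ (volume_setOf_inner_eq_zero (∑ j ∈ I, c₀ j • X ξ₀ j) hσ)
  rintro ξ ⟨c, h1, h2⟩
  change ∀ i ∈ I, inner ℝ (∑ j ∈ I, c j • X ξ j) (X ξ i) = σ i at h1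
  change inner ℝ (∑ j ∈ I, c j • X ξ j) (X ξ k) = σ k at h2
  have hsum : ∑ j ∈ I, c j • X ξ j = ∑ j ∈ I, c j • X ξ₀ j :=
    Finset.sum_congr rfl fun j hj => by rw [hXi ξ hj]
  rw [hsum, hXk] at h2
  rw [hsum] at h1
  rw [Set.mem_ofPred_eq, ← h2, sum_smul_eq_of_inner_eq fun i hi => ?_]
  rw [← hXi ξ hi, h1 i hi, hXi ξ hi]
  exact h₀ i hi

/-- The data `x` with labels `σ` are in general position: a vector of the span of some of the
points that takes the label values on them does not take the label value on another point. -/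
def InGeneralPosition {n : ℕ} (x : Fin n → Vec d) (σ : Fin n → ℝ) : Prop :=
  ∀ (I : Finset (Fin n)) (c : Fin n → ℝ),
    (∀ i ∈ I, inner ℝ (∑ j ∈ I, c j • x j) (x i) = σ i) →
      ∀ k ∉ I, inner ℝ (∑ j ∈ I, c j • x j) (x k) ≠ σ k

lemma ae_inGeneralPosition (n : ℕ) :
    ∀ᵐ x : Fin n → Vec d, ∀ σ : Fin n → ℝ, (∀ i, σ i = 1 ∨ σ i = -1) →
      InGeneralPosition x σ := by
  obtain _ | m := n
  · exact Filter.Eventually.of_forall fun _ _ _ _ _ _ k => k.elim0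
  have hfin : {σ : Fin (m + 1) → ℝ | ∀ i, σ i = 1 ∨ σ i = -1}.Countable := by
    refine Set.Finite.countable ((Set.Finite.pi' fun _ => Set.toFinite {(1 : ℝ), -1}).subset ?_)
    intro σ hσ
    simpa using hσ
  refine (ae_ball_iff hfin).2 fun σ hσ => ?_
  have h : ∀ᵐ x : Fin (m + 1) → Vec d, ∀ (I : Finset (Fin (m + 1))) (k : Fin (m + 1)), k ∉ I →
      ¬ ∃ c : Fin (m + 1) → ℝ, (∀ i ∈ I, inner ℝ (∑ j ∈ I, c j • x j) (x i) = σ i) ∧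
        inner ℝ (∑ j ∈ I, c j • x j) (x k) = σ k := by
    refine ae_all_iff.2 fun I => ae_all_iff.2 fun k => ?_
    by_cases hk : k ∈ I
    · exact Filter.Eventually.of_forall fun _ h => absurd hk h
    have hσk : σ k ≠ 0 := by rcases hσ k with h | h <;> norm_num [h]
    filter_upwards [measure_eq_zero_iff_ae_notMem.1
      (volume_setOf_exists_inner_eq (d := d) hk hσk)] with x hx _
    exact hx
  filter_upwards [h] with x hx I c hI k hk hck
  exact hx I k hk ⟨c, hI, hck⟩

end GeneralPosition

/-! ### Minimizing a sum of exponentials over the span of its exponents -/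

section SumExp

variable {ι E : Type*} [NormedAddCommGroup E] [InnerProductSpace ℝ E] {s : Finset ι} {z : ι → E}

lemma eq_zero_of_mem_span_of_inner_eq_zero {w : E} (hw : w ∈ Submodule.span ℝ (z '' s))
    (h : ∀ i ∈ s, inner ℝ w (z i) = 0) : w = 0 := by
  have : Submodule.span ℝ (z '' s) ≤ LinearMap.ker (innerₗ E w) := by
    rw [Submodule.span_le]
    rintro _ ⟨i, hi, rfl⟩
    exact h i hi
  exact inner_self_eq_zero (𝕜 := ℝ).1 (this hw)

/-- If `0` is a combination of the `z i` with positive weights, then the sum of exponentials has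
compact sublevel sets in the span of the `z i`, hence a minimizer there. -/
lemma exists_isMinOn_sum_exp {q : ι → ℝ} (hs : s.Nonempty) (hq : ∀ i ∈ s, 0 < q i)
    (hqz : ∑ i ∈ s, q i • z i = 0) :
    ∃ v ∈ Submodule.span ℝ (z '' s), IsMinOn (fun w => ∑ i ∈ s, Real.exp (inner ℝ w (z i)))
      (Submodule.span ℝ (z '' s) : Set E) v := by
  set V := Submodule.span ℝ (z '' s) with hV
  have : FiniteDimensional ℝ V := FiniteDimensional.span_of_finite ℝ (s.finite_toSet.image z)
  let T : V →ₗ[ℝ] (s → ℝ) := LinearMap.pi fun i => (innerₗ E (z i)) ∘ₗ V.subtype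
  have hT (w : V) (i : s) : T w i = inner ℝ (w : E) (z i) := real_inner_comm _ _
  have hker : LinearMap.ker T = ⊥ := by
    rw [LinearMap.ker_eq_bot']
    intro w hw
    refine Subtype.ext (eq_zero_of_mem_span_of_inner_eq_zero w.2 fun i hi => ?_)
    rw [← hT w ⟨i, hi⟩, hw, Pi.zero_apply]
  have hcard : (1 : ℝ) ≤ s.card := by exact_mod_cast hs.card_pos
  set L := Real.log s.card with hL
  have hL0 : 0 ≤ L := Real.log_nonneg hcard
  have hQ : 0 < ∑ i ∈ s, q i := Finset.sum_pos hq hs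
  let B : Set (s → ℝ) := Set.univ.pi fun i => Set.Icc (-(L * (∑ j ∈ s, q j) / q i)) L
  have hK : IsCompact (T ⁻¹' B) :=
    (LinearMap.isClosedEmbedding_of_injective hker).isCompact_preimage
      (isCompact_univ_pi fun _ => isCompact_Icc)
  -- the sublevel set at the value `#s` taken at the origin lies in `T ⁻¹' B`
  have hsub (w : V) (hw : ∑ i ∈ s, Real.exp (inner ℝ (w : E) (z i)) ≤ s.card) : w ∈ T ⁻¹' B := by
    have hup (i) (hi : i ∈ s) : inner ℝ (w : E) (z i) ≤ L := by
      rw [hL, Real.le_log_iff_exp_le (by linarith)]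
      exact (Finset.single_le_sum (f := fun i => Real.exp (inner ℝ (w : E) (z i)))
        (fun _ _ => (Real.exp_pos _).le) hi).trans hw
    have h0 : ∑ i ∈ s, q i * inner ℝ (w : E) (z i) = 0 := by
      simp_rw [← inner_smul_right, ← inner_sum, hqz, inner_zero_right]
    rintro ⟨i, hi⟩ -
    rw [hT]
    refine ⟨?_, hup i hi⟩
    rw [neg_le, ← neg_le_neg_iff, neg_neg, ← neg_div, div_le_iff₀ (hq i hi)]
    have h1 : q i * (L - inner ℝ (w : E) (z i)) ≤ ∑ j ∈ s, q j * (L - inner ℝ (w : E) (z j)) :=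
      Finset.single_le_sum (f := fun j => q j * (L - inner ℝ (w : E) (z j)))
        (fun j hj => mul_nonneg (hq j hj).le (sub_nonneg.2 (hup j hj))) hi
    simp_rw [mul_sub, Finset.sum_sub_distrib, h0, ← Finset.sum_mul] at h1
    nlinarith [mul_nonneg (hq i hi).le hL0]
  have h0 : ∑ i ∈ s, Real.exp (inner ℝ ((0 : V) : E) (z i)) = s.card := by simp
  have hcont : Continuous fun w : V => ∑ i ∈ s, Real.exp (inner ℝ (w : E) (z i)) := by fun_prop
  obtain ⟨v, -, hv⟩ := hK.exists_isMinOn ⟨0, hsub 0 h0.le⟩ hcont.continuousOn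
  refine ⟨v, v.2, fun w hw => ?_⟩
  by_cases h : ∑ i ∈ s, Real.exp (inner ℝ w (z i)) ≤ s.card
  · exact hv (hsub ⟨w, hw⟩ h)
  · exact (hv (hsub 0 h0.le)).trans (h0.le.trans (not_le.1 h).le)

/-- Uniqueness of the minimizer, by strict convexity of the exponential. -/
lemma eq_of_isMinOn_sum_exp {v v' : E} (hv : v ∈ Submodule.span ℝ (z '' s))
    (hv' : v' ∈ Submodule.span ℝ (z '' s))
    (hmin : IsMinOn (fun w => ∑ i ∈ s, Real.exp (inner ℝ w (z i)))
      (Submodule.span ℝ (z '' s) : Set E) v)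
    (hmin' : IsMinOn (fun w => ∑ i ∈ s, Real.exp (inner ℝ w (z i)))
      (Submodule.span ℝ (z '' s) : Set E) v') : v = v' := by
  by_contra hne
  obtain ⟨i, hi, hi'⟩ : ∃ i ∈ s, inner ℝ v (z i) ≠ inner ℝ v' (z i) := by
    by_contra! h
    refine hne (sub_eq_zero.1 (eq_zero_of_mem_span_of_inner_eq_zero (sub_mem hv hv')
      fun i hi => ?_))
    rw [inner_sub_left, h i hi, sub_self]
  have hmid (j) : inner ℝ ((1 / 2 : ℝ) • v + (1 / 2 : ℝ) • v') (z j) =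
      (1 / 2 : ℝ) • inner ℝ v (z j) + (1 / 2 : ℝ) • inner ℝ v' (z j) := by
    simp [inner_add_left, real_inner_smul_left]
  have hlt : ∑ j ∈ s, Real.exp (inner ℝ ((1 / 2 : ℝ) • v + (1 / 2 : ℝ) • v') (z j)) <
      ∑ j ∈ s, ((1 / 2 : ℝ) • Real.exp (inner ℝ v (z j)) +
        (1 / 2 : ℝ) • Real.exp (inner ℝ v' (z j))) := by
    refine Finset.sum_lt_sum (fun j _ => ?_) ⟨i, hi, ?_⟩
    · rw [hmid]
      exact convexOn_exp.2 trivial trivial (by norm_num) (by norm_num) (by norm_num)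
    · rw [hmid]
      exact strictConvexOn_exp.2 trivial trivial hi' (by norm_num) (by norm_num) (by norm_num)
  have hm := (Submodule.span ℝ (z '' s)).add_mem (Submodule.smul_mem _ (1 / 2 : ℝ) hv)
    (Submodule.smul_mem _ (1 / 2 : ℝ) hv')
  have h1 := hmin hm
  have h2 := hmin' hm
  simp only [Set.mem_ofPred_eq] at h1 h2
  rw [Finset.sum_add_distrib, ← Finset.smul_sum, ← Finset.smul_sum, smul_eq_mul,
    smul_eq_mul] at hlt
  linarith

/-- A minimizer over the span is a global minimizer. -/
lemma sum_exp_le_of_isMinOn_span {v : E}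
    (hmin : IsMinOn (fun w => ∑ i ∈ s, Real.exp (inner ℝ w (z i)))
      (Submodule.span ℝ (z '' s) : Set E) v) (w : E) :
    ∑ i ∈ s, Real.exp (inner ℝ v (z i)) ≤ ∑ i ∈ s, Real.exp (inner ℝ w (z i)) := by
  set V := Submodule.span ℝ (z '' s) with hV
  have : FiniteDimensional ℝ V := FiniteDimensional.span_of_finite ℝ (s.finite_toSet.image z)
  refine (hmin (V.starProjection_apply_mem w)).trans_eq (Finset.sum_congr rfl fun i hi => ?_)
  have := V.starProjection_inner_eq_zero w (z i) (Submodule.subset_span ⟨i, hi, rfl⟩)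
  rw [inner_sub_left, sub_eq_zero] at this
  rw [this]

end SumExp

/-! ### Gradient descent on the exponential risk -/

section GradientDescent

variable {n d : ℕ} {z : Fin n → Vec d} {u : Vec d}

lemma risk_nonneg (z : Fin n → Vec d) (w : Vec d) : 0 ≤ risk z w :=
  mul_nonneg (by positivity) (Finset.sum_nonneg fun _ _ => (Real.exp_pos _).le)

lemma gradient_risk [Nonempty (Fin n)] (z : Fin n → Vec d) (w : Vec d) :
    gradient (risk z) w = risk z w • softmaxMean Finset.univ z w := by
  have hS := (sum_exp_inner_pos (z := z) Finset.univ_nonempty w).ne'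
  have hsm : risk z w • softmaxMean Finset.univ z w =
      (1 / (n : ℝ)) • ∑ i, Real.exp (inner ℝ w (z i)) • z i := by
    rw [risk, mul_smul, softmaxMean, Finset.smul_sum]
    congr 1
    refine Finset.sum_congr rfl fun i _ => ?_
    rw [smul_smul, softmax, mul_div_cancel₀ _ hS]
  rw [hsm]
  refine HasGradientAt.gradient ?_
  rw [hasGradientAt_iff_hasFDerivAt]
  have h (i : Fin n) : HasFDerivAt (fun w : Vec d => Real.exp (inner ℝ w (z i)))
      (Real.exp (inner ℝ w (z i)) • innerSL ℝ (z i)) w := by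
    have h1 : HasFDerivAt (fun w : Vec d => (inner ℝ w (z i) : ℝ)) (innerSL ℝ (z i)) w := by
      simp_rw [real_inner_comm (z i)]
      exact (innerSL ℝ (z i)).hasFDerivAt
    exact h1.exp
  have h2 := (HasFDerivAt.fun_sum (u := Finset.univ) fun i _ => h i).const_mul (1 / (n : ℝ))
  refine h2.congr_fderiv ?_
  ext x
  simp [Finset.mul_sum]

/-- In terms of the normalized step sizes, gradient descent on the risk is gradient descent on
log-sum-exp. -/
lemma gdIterate_succ [Nonempty (Fin n)] (z : Fin n → Vec d) (η : ℕ → ℝ) (t : ℕ) :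
    gdIterate z η (t + 1) = gdIterate z η t -
      normalizedStep z η t • softmaxMean Finset.univ z (gdIterate z η t) := by
  rw [gdIterate, gradient_risk, smul_smul, normalizedStep]

lemma perp_sub (u a b : Vec d) : perp u (a - b) = perp u a - perp u b := by
  simp only [perp, inner_sub_left, sub_smul]
  abel

lemma perp_smul (u : Vec d) (c : ℝ) (a : Vec d) : perp u (c • a) = c • perp u a := by
  simp only [perp, real_inner_smul_left, smul_sub, smul_smul]

lemma perp_sum {ι : Type*} (u : Vec d) (s : Finset ι) (a : ι → Vec d) :
    perp u (∑ i ∈ s, a i) = ∑ i ∈ s, perp u (a i) := by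
  simp only [perp, sum_inner, Finset.sum_smul, Finset.sum_sub_distrib]

lemma inner_perp_perp (hu : ‖u‖ = 1) (a b : Vec d) :
    inner ℝ (perp u a) (perp u b) = inner ℝ a b - inner ℝ a u * inner ℝ b u := by
  simp only [perp, inner_sub_left, inner_sub_right, real_inner_smul_left, inner_smul_right,
    real_inner_self_eq_norm_sq, hu, real_inner_comm b u]
  ring

lemma norm_perp_le (hu : ‖u‖ = 1) (a : Vec d) : ‖perp u a‖ ≤ ‖a‖ := by
  refine (pow_le_pow_iff_left₀ (norm_nonneg _) (norm_nonneg _) two_ne_zero).1 ?_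
  rw [← real_inner_self_eq_norm_sq, inner_perp_perp hu, real_inner_self_eq_norm_sq]
  nlinarith [mul_self_nonneg (inner ℝ a u)]

/-- On the support vectors the factor `exp (-γ ⟪w, u⟫)` is common, so that up to normalization the
softmax weights of `w` are those of its orthogonal component. -/
lemma softmax_eq_mul_softmax_perp [Nonempty (Fin n)] (hu : ‖u‖ = 1) (w : Vec d) {i : Fin n}
    (hi : i ∈ supportIdx z u) :
    softmax Finset.univ z w i = (∑ j ∈ supportIdx z u, softmax Finset.univ z w j) *
      softmax (supportIdx z u) (fun j => perp u (z j)) (perp u w) i := by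
  have hexp {j} (hj : j ∈ supportIdx z u) : Real.exp (inner ℝ w (z j)) =
      Real.exp (-(maxMargin z * inner ℝ w u)) * Real.exp (inner ℝ (perp u w) (perp u (z j))) := by
    have hj' : inner ℝ (z j) u = -maxMargin z := by
      simp only [supportIdx, Finset.mem_filter, Finset.mem_univ, true_and, inner_neg_right] at hj
      rw [real_inner_comm]
      linarith
    rw [← Real.exp_add, inner_perp_perp hu, hj']
    ring_nf
  have hne := (sum_exp_inner_pos (z := fun j => perp u (z j)) ⟨i, hi⟩ (perp u w)).ne'
  have hne' := (sum_exp_inner_pos (z := z) Finset.univ_nonempty w).ne'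
  simp only [softmax]
  rw [← Finset.sum_div, Finset.sum_congr rfl fun j hj => hexp hj, ← Finset.mul_sum, hexp hi]
  field_simp

/-- One step of gradient descent moves the orthogonal component away from the minimizer by at most
the step taken along the data points that are not support vectors. -/
lemma norm_perp_sub_step_le [Nonempty (Fin n)] (hu : ‖u‖ = 1) (hz : ∀ i, ‖z i‖ ≤ 1)
    (hS : (supportIdx z u).Nonempty) {vbar : Vec d}
    (hv : ∀ v, logSumExp (supportIdx z u) (fun i => perp u (z i)) vbar ≤
      logSumExp (supportIdx z u) (fun i => perp u (z i)) v)
    (w : Vec d) {a : ℝ} (ha0 : 0 ≤ a) (ha1 : a ≤ 1) :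
    ‖perp u (w - a • softmaxMean Finset.univ z w) - vbar‖ ≤ ‖perp u w - vbar‖ +
      a * ∑ i ∈ Finset.univ \ supportIdx z u, softmax Finset.univ z w i := by
  set S := supportIdx z u with hSdef
  set N := ∑ i ∈ Finset.univ \ S, softmax Finset.univ z w i • perp u (z i) with hN
  set A := ∑ i ∈ S, softmax Finset.univ z w i with hA
  have hz' (i) : ‖perp u (z i)‖ ≤ 1 := (norm_perp_le hu _).trans (hz i)
  have hA0 : 0 ≤ A := Finset.sum_nonneg fun _ _ => softmax_nonneg _ _
  have hA1 : A ≤ 1 := (Finset.sum_le_sum_of_subset_of_nonneg (Finset.subset_univ _)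
    fun _ _ _ => softmax_nonneg _ _).trans (sum_softmax Finset.univ_nonempty w).le
  have hsplit : perp u (softmaxMean Finset.univ z w) =
      N + A • softmaxMean S (fun i => perp u (z i)) (perp u w) := by
    rw [softmaxMean, perp_sum, ← Finset.sum_sdiff (Finset.subset_univ S), softmaxMean,
      Finset.smul_sum]
    simp_rw [perp_smul, smul_smul]
    refine congrArg₂ _ rfl (Finset.sum_congr rfl fun i hi => ?_)
    rw [softmax_eq_mul_softmax_perp hu w hi]
  have hN1 : ‖N‖ ≤ ∑ i ∈ Finset.univ \ S, softmax Finset.univ z w i := by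
    refine (norm_sum_le _ _).trans (Finset.sum_le_sum fun i _ => ?_)
    rw [norm_smul, Real.norm_eq_abs, abs_of_nonneg (softmax_nonneg _ _)]
    exact mul_le_of_le_one_right (softmax_nonneg _ _) (hz' i)
  have hcontr := norm_sub_smul_softmaxMean_sub_le hS (fun i _ => hz' i) hv (perp u w)
    (mul_nonneg ha0 hA0) (mul_le_one₀ ha1 hA0 hA1)
  rw [perp_sub, perp_smul, hsplit, smul_add, smul_smul]
  calc _ = ‖(perp u w - (a * A) • softmaxMean S (fun i => perp u (z i)) (perp u w) - vbar)
        - a • N‖ := by congr 1; abel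
    _ ≤ _ := norm_sub_le _ _
    _ ≤ _ := by
      refine add_le_add hcontr ?_
      rw [norm_smul, Real.norm_eq_abs, abs_of_nonneg ha0]
      exact mul_le_mul_of_nonneg_left hN1 ha0

lemma norm_perp_gdIterate_sub_le [Nonempty (Fin n)] (hu : ‖u‖ = 1) (hz : ∀ i, ‖z i‖ ≤ 1)
    (hS : (supportIdx z u).Nonempty) {vbar : Vec d}
    (hv : ∀ v, logSumExp (supportIdx z u) (fun i => perp u (z i)) vbar ≤
      logSumExp (supportIdx z u) (fun i => perp u (z i)) v)
    {η : ℕ → ℝ} (h0 : ∀ j, 0 ≤ normalizedStep z η j) (h1 : ∀ j, normalizedStep z η j ≤ 1) (t : ℕ) :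
    ‖perp u (gdIterate z η t) - vbar‖ ≤ ‖perp u (gdIterate z η 0) - vbar‖ +
      ∑ j ∈ Finset.range t, normalizedStep z η j *
        ∑ i ∈ Finset.univ \ supportIdx z u, softmax Finset.univ z (gdIterate z η j) i := by
  induction t with
  | zero => simp
  | succ t ih =>
    rw [gdIterate_succ, Finset.sum_range_succ]
    linarith [norm_perp_sub_step_le hu hz hS hv (gdIterate z η t) (h0 t) (h1 t)]

end GradientDescent

/-! ### Support vectors of data in general position -/

section Support

variable {n d : ℕ}

/-- Strict complementarity: in general position every support vector has positive dual weight.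
Indeed `γ⁻¹ u` is a combination of the support vectors of positive weight, it takes the label
values on them, and it does so on every other support vector. -/
lemma ne_zero_of_mem_supportIdx {x : Fin n → Vec d} {σ : Fin n → ℝ}
    (hσ : ∀ i, σ i = 1 ∨ σ i = -1) (hgen : InGeneralPosition x σ) {u : Vec d} {q : Fin n → ℝ}
    (hu : ‖u‖ = 1) (hγ : 0 < maxMargin (signedData x σ)) (hq0 : ∀ i, 0 ≤ q i) (hq1 : ∑ i, q i = 1)
    (hqu : ∑ i, q i • signedData x σ i = -(maxMargin (signedData x σ) • u))
    (hmargin : ∀ i, maxMargin (signedData x σ) ≤ inner ℝ u (-signedData x σ i)) {k : Fin n}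
    (hk : k ∈ supportIdx (signedData x σ) u) : q k ≠ 0 := by
  set γ := maxMargin (signedData x σ) with hγdef
  intro hqk
  let I := Finset.univ.filter fun i => q i ≠ 0
  let c : Fin n → ℝ := fun i => γ⁻¹ * γ⁻¹ * (q i * σ i)
  have hsum : ∑ j ∈ I, c j • x j = γ⁻¹ • u := by
    have h1 : ∑ j, (q j * σ j) • x j = γ • u := by
      simpa [signedData, smul_smul] using hqu
    have h2 : ∑ j ∈ I, c j • x j = ∑ j, c j • x j := by
      refine Finset.sum_subset (Finset.subset_univ _) fun j _ hj => ?_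
      have : q j = 0 := by simpa [I] using hj
      simp [c, this]
    simp_rw [h2, c, mul_smul _ (_ * _), ← Finset.smul_sum, h1, mul_smul,
      inv_smul_smul₀ hγ.ne']
  have hval {i} (hi : i ∈ supportIdx (signedData x σ) u) :
      inner ℝ (∑ j ∈ I, c j • x j) (x i) = σ i := by
    have h1 : σ i * inner ℝ u (x i) = γ := by
      simpa [supportIdx, signedData, inner_smul_right] using hi
    have h2 : σ i * σ i = 1 := by rcases hσ i with h | h <;> norm_num [h]
    rw [hsum, real_inner_smul_left, inv_mul_eq_div, div_eq_iff hγ.ne', ← h1, ← mul_assoc, h2,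
      one_mul]
  refine hgen I c (fun i hi => hval ?_) k (by simp [I, hqk]) (hval hk)
  exact mem_supportIdx_of_ne_zero hu hq0 hq1 hqu hmargin (by simpa [I] using hi)

lemma isRiskPerpMinimizer_iff (hn : 1 ≤ n) {z : Fin n → Vec d} {u v : Vec d} :
    IsRiskPerpMinimizer z u v ↔ v ∈ Submodule.span ℝ ((fun i => perp u (z i)) '' supportIdx z u) ∧
      IsMinOn (fun w => ∑ i ∈ supportIdx z u, Real.exp (inner ℝ w (perp u (z i))))
        (Submodule.span ℝ ((fun i => perp u (z i)) '' supportIdx z u) : Set (Vec d)) v := by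
  have hn' : (0 : ℝ) < 1 / n := by positivity
  simp only [IsRiskPerpMinimizer, supportPerpSpan, isMinOn_iff, riskPerp,
    mul_le_mul_iff_right₀ hn']

/-- Comparison with the gap `γ'`, which is either `⊤`, when every point is a support vector, or a
positive real number. -/
lemma marginGap_cases {z : Fin n → Vec d} {u : Vec d}
    (hmargin : ∀ i, maxMargin z ≤ inner ℝ u (-z i)) :
    (Finset.univ \ supportIdx z u = ∅ ∧ marginGap z u = ⊤) ∨
      ∃ δ : ℝ, 0 < δ ∧ marginGap z u = δ ∧
        ∀ i ∈ Finset.univ \ supportIdx z u, maxMargin z + δ ≤ inner ℝ u (-z i) := by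
  rcases Finset.eq_empty_or_nonempty (supportIdx z u)ᶜ with h | h
  · exact .inl ⟨by rwa [← Finset.compl_eq_univ_sdiff], by simp [marginGap, h]⟩
  · obtain ⟨i, hi, hmin⟩ := Finset.exists_min_image _
      (fun i => (inner ℝ u (-z i) - maxMargin z : ℝ)) h
    refine .inr ⟨inner ℝ u (-z i) - maxMargin z, ?_, ?_, fun j hj => ?_⟩
    · refine sub_pos.2 (lt_of_le_of_ne (hmargin i) fun h => ?_)
      rw [Finset.mem_compl, supportIdx, Finset.mem_filter] at hi
      exact hi ⟨Finset.mem_univ _, h.symm⟩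
    · exact le_antisymm (iInf₂_le i hi)
        (le_iInf₂ fun j hj => EReal.coe_le_coe_iff.2 (hmin j hj))
    · rw [← Finset.compl_eq_univ_sdiff] at hj
      linarith [hmin j hj]

end Support

/-! ### Distance of the iterates to the minimizer -/

theorem mainTheorem4 {Ω : Type*} [MeasurableSpace Ω] (P : Measure Ω) [IsProbabilityMeasure P]
    (n d : ℕ) (hn : 1 ≤ n)
    (x : Fin n → Ω → Vec d) (y : Fin n → Ω → ℝ)
    (hy : ∀ i ω, y i ω = 1 ∨ y i ω = -1)
    (hx : HasPDF (fun ω i => x i ω) P volume) :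
    ∀ᵐ ω ∂P,
      (∀ i, ‖x i ω‖ ≤ 1) →
      LinearlySeparable (fun i => x i ω) (fun i => y i ω) →
      ∀ z : Fin n → Vec d, z = signedData (fun i => x i ω) (fun i => y i ω) →
        (∃! u : Vec d, IsMaxMarginDirection z u) ∧
        ∀ u : Vec d, IsMaxMarginDirection z u →
          (∃! v : Vec d, IsRiskPerpMinimizer z u v) ∧
          ∀ vbar : Vec d, IsRiskPerpMinimizer z u vbar →
            ∀ η : ℕ → ℝ, (∀ j, 0 ≤ η j) →
              (∀ j, normalizedStep z η j ≤ 1) →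
              Antitone (normalizedStep z η) →
              ∀ t : ℕ,
                ((‖perp u (gdIterate z η t) - vbar‖ : ℝ) : EReal) ≤
                  ((max ‖perp u (gdIterate z η 0) - vbar‖ 2 : ℝ) : EReal)
                    + ((2 * Real.log n : ℝ) : EReal)
                        / (((maxMargin z : ℝ) : EReal) * marginGap z u)
                    + 2 := by
  have : Nonempty (Fin n) := ⟨⟨0, hn⟩⟩
  filter_upwards [ae_of_ae_map hx.aemeasurable
    (hx.absolutelyContinuous.ae_le (ae_inGeneralPosition n))] with ω hω hx1 hsep z hzdef
  have hgen := hω (fun i => y i ω) fun i => hy i ω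
  have hz (i) : ‖z i‖ ≤ 1 := by
    have : |y i ω| = 1 := by rcases hy i ω with h | h <;> simp [h]
    simpa [hzdef, signedData, norm_smul, this] using hx1 i
  have hsep' : ∃ u : Vec d, ∀ i, 0 < inner ℝ u (-z i) := by
    obtain ⟨u, hu⟩ := hsep
    exact ⟨u, fun i => by simpa [hzdef, signedData, inner_smul_right] using hu i⟩
  obtain ⟨u₀, q, hmax, huniq, hγ, hq0, hq1, hqu, hmargin⟩ := exists_isMaxMarginDirection hsep'
  refine ⟨⟨u₀, hmax, huniq⟩, fun u hu => ?_⟩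
  obtain rfl := huniq u hu
  have hu1 : ‖u‖ = 1 := by simpa using hu.1
  have hqpos (i) (hi : i ∈ supportIdx z u) : 0 < q i := by
    subst hzdef
    exact (hq0 i).lt_of_ne' (ne_zero_of_mem_supportIdx (fun i => hy i ω) hgen hu1 hγ hq0 hq1 hqu
      hmargin hi)
  have hqsupp (i) (hi : i ∉ supportIdx z u) : q i = 0 := by
    by_contra h
    exact hi (mem_supportIdx_of_ne_zero hu1 hq0 hq1 hqu hmargin h)
  have hS : (supportIdx z u).Nonempty := by
    by_contra h
    rw [Finset.not_nonempty_iff_eq_empty] at h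
    simp [hqsupp, h] at hq1
  have hqperp : ∑ i ∈ supportIdx z u, q i • perp u (z i) = 0 := by
    rw [Finset.sum_subset (Finset.subset_univ _) fun i _ hi => by rw [hqsupp i hi, zero_smul]]
    simp_rw [← perp_smul, ← perp_sum, hqu]
    simp [perp, real_inner_smul_left, hu1]
  obtain ⟨v, hvV, hvmin⟩ := exists_isMinOn_sum_exp hS hqpos hqperp
  simp_rw [isRiskPerpMinimizer_iff hn]
  refine ⟨⟨v, ⟨hvV, hvmin⟩, fun v' hv' => eq_of_isMinOn_sum_exp hv'.1 hvV hv'.2 hvmin⟩, ?_⟩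
  rintro vbar ⟨-, hmin⟩ η hη h1 hanti t
  have h0 (j) : 0 ≤ normalizedStep z η j := mul_nonneg (hη j) (risk_nonneg _ _)
  have hbound := norm_perp_gdIterate_sub_le hu1 hz hS
    (fun v => Real.log_le_log (sum_exp_inner_pos hS _) (sum_exp_le_of_isMinOn_span hmin v)) h0 h1 t
  have h2 : (2 : EReal) = ((2 : ℝ) : EReal) := rfl
  rcases marginGap_cases hmargin with ⟨hempty, hgap⟩ | ⟨δ, hδ, hgap, hδle⟩
  · rw [hgap, EReal.coe_mul_top_of_pos hγ, EReal.div_top, add_zero]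
    simp only [hempty, Finset.sum_empty, mul_zero, Finset.sum_const_zero, add_zero] at hbound
    have : ‖perp u (gdIterate z η t) - vbar‖ ≤ max ‖perp u (gdIterate z η 0) - vbar‖ 2 + 2 := by
      linarith [le_max_left ‖perp u (gdIterate z η 0) - vbar‖ 2]
    rw [h2, ← EReal.coe_add]
    exact EReal.coe_le_coe_iff.2 this
  · have hsum := sum_mul_sum_softmax_le Finset.univ_nonempty (Finset.subset_univ _)
      (fun i _ => hz i) hu1 hγ hδ (fun i _ => hmargin i) hδle (fun i _ => hq0 i) hq1 hqu rfl
      (gdIterate_succ z η) h0 h1 hanti t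
    rw [Finset.card_univ, Fintype.card_fin] at hsum
    have hlog : 0 ≤ Real.log n / (maxMargin z * δ) :=
      div_nonneg (Real.log_natCast_nonneg n) (by positivity)
    have : ‖perp u (gdIterate z η t) - vbar‖ ≤ max ‖perp u (gdIterate z η 0) - vbar‖ 2 +
        2 * Real.log n / (maxMargin z * δ) + 2 := by
      rw [mul_div_assoc]
      linarith [le_max_left ‖perp u (gdIterate z η 0) - vbar‖ 2]
    rw [hgap, ← EReal.coe_mul, ← EReal.coe_div, h2, ← EReal.coe_add, ← EReal.coe_add]
    exact EReal.coe_le_coe_iff.2 this
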